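/- Let $\mathcal T$ be the rooted binary tree whose vertices are the finite words over $\{0,1\}$, and let $\mathcal G=\langle a,b,c,d\rangle$ be the Grigorchuk group, generated by the automorphisms $a,b,c,d$ of $\mathcal T$ that fix the empty word and satisfy, for every word $w$, $$a(0w)=1w,\quad a(1w)=0w,\quad b(0w)=0a(w),\quad b(1w)=1c(w),$$ $$c(0w)=0a(w),\quad c(1w)=1d(w),\quad d(0w)=0w,\quad d(1w)=1b(w).$$ For a finitely generated group $H$ let $d(H)$ be the minimal number of generators of $H$. A finitely generated group $G$ is called normally $(f,g)$-RG-rigid if there is $C\in\mathbb N$ such that $$g(d(H))<C\,f(C[G:H])\quad\text{and}\quad f([G:H])<C\,g(C\,d(H))$$ for every normal subgroup $H\lhd G$ of finite index. Let $\log$ be the natural logarithm. **Theorem 1.** The group $\mathcal G$ is normally $(f,g)$-RG-rigid with $f(n)=\log\log n$ and $g(n)=\log n$. (For $C\ge 2$ the value $f(1)$ occurs only in the second inequality for $H=\mathcal G$, which holds whether $f(1)$ is read as $-\infty$ or as $0$.) Moreover, there is a constant $D>1$ such that every nontrivial normal subgroup $H\lhd\mathcal G$ has finite index and satisfies $$\frac1D\log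 d(H)\le\log\log[\mathcal G:H]\quad\text{if } [\mathcal G:H]>2,$$ $$\log\log[\mathcal G:H]\le D\log d(H)\quad\text{if } H\ne\mathcal G.$$ -/

import Mathlib

/-! Vertices of the rooted binary tree are the finite words over the alphabet with letters
`false` (the digit 0) and `true` (the digit 1), that is, terms of `List Bool`; the root is `[]`. -/

namespace Grigorchuk

/-- The generator `a` on vertices: `a(0w) = 1w`, `a(1w) = 0w`. -/
def aFun : List Bool → List Bool
  | [] => []
  | x :: w => (!x) :: w

mutual

/-- The generator `b` on vertices: `b(0w) = 0a(w)`, `b(1w) = 1c(w)`. -/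
def bFun : List Bool → List Bool
  | [] => []
  | false :: w => false :: aFun w
  | true :: w => true :: cFun w

/-- The generator `c` on vertices: `c(0w) = 0a(w)`, `c(1w) = 1d(w)`. -/
def cFun : List Bool → List Bool
  | [] => []
  | false :: w => false :: aFun w
  | true :: w => true :: dFun w

/-- The generator `d` on vertices: `d(0w) = 0w`, `d(1w) = 1b(w)`. -/
def dFun : List Bool → List Bool
  | [] => []
  | false :: w => false :: w
  | true :: w => true :: bFun w

end

theorem aFun_involutive : Function.Involutive aFun := by
  intro w
  cases w <;> simp [aFun]

theorem bcdFun_involutive (w : List Bool) :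
    bFun (bFun w) = w ∧ cFun (cFun w) = w ∧ dFun (dFun w) = w := by
  induction w with
  | nil => simp [bFun, cFun, dFun]
  | cons x w ih =>
    cases x <;> simp [bFun, cFun, dFun, ih, aFun_involutive w]

/-- The generator `a` as a permutation of the vertices of the tree. -/
def a : Equiv.Perm (List Bool) := aFun_involutive.toPerm aFun

/-- The generator `b` as a permutation of the vertices of the tree. -/
def b : Equiv.Perm (List Bool) :=
  Function.Involutive.toPerm bFun fun w => (bcdFun_involutive w).1

/-- The generator `c` as a permutation of the vertices of the tree. -/
def c : Equiv.Perm (List Bool) :=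
  Function.Involutive.toPerm cFun fun w => (bcdFun_involutive w).2.1

/-- The generator `d` as a permutation of the vertices of the tree. -/
def d : Equiv.Perm (List Bool) :=
  Function.Involutive.toPerm dFun fun w => (bcdFun_involutive w).2.2

end Grigorchuk

/-- The Grigorchuk group: the group of automorphisms of the rooted binary tree generated by
`a, b, c, d`, as a group of permutations of the vertices. -/
def GrigorchukGroup : Subgroup (Equiv.Perm (List Bool)) :=
  Subgroup.closure {Grigorchuk.a, Grigorchuk.b, Grigorchuk.c, Grigorchuk.d}

instance GrigorchukGroup.instFG : Group.FG GrigorchukGroup :=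
  Group.closure_finite_fg _

/-- A finitely generated group `G` is normally `(f, g)`-RG-rigid if there is a natural number `C`
such that `g (d(H)) < C f (C [G : H])` and `f ([G : H]) < C g (C d(H))` for every normal subgroup
`H` of finite index, where `d(H)`, the minimal number of generators of `H`, is `Group.rank H`. -/
def IsNormallyRGRigid (f g : ℕ → ℝ) (G : Type*) [Group G] [Group.FG G] : Prop :=
  ∃ C : ℕ, ∀ (H : Subgroup G) [H.Normal] [H.FiniteIndex],
    g (Group.rank H) < C * f (C * H.index) ∧ f H.index < C * g (C * Group.rank H)

-- For a nontrivial normal `H`, let `n` be the last level fixed pointwise by `H`. Both `log d(H)`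
-- and `log log [G : H]` are comparable with `n + 1`, up to constants that do not depend on `H`.
--
-- The source of upper bounds is branching. Let `K` be the normal closure of `(ab)²`. It has finite
-- index, so does its commutator subgroup `K'`, and a copy of `K` lies in the group below every
-- vertex. If an element of `H` moves a vertex of level `n + 1`, two commutators with copies of `K`
-- below that vertex produce a copy of `K'` inside `H`, and transitivity gives the copies on the
-- whole level (`levelSubgroup_le`). The subgroup they generate has explicitly bounded index and
-- rank (`index_levelSubgroup`, `exists_finset_closure_levelSubgroup`), so `log [G : H]` and `d(H)`
-- grow at most exponentially in `n`.
--
-- The source of lower bounds is one nontrivial `k` in `K'`, moving a word of length `m`. Inserting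
-- `k` or nothing below each vertex of level `l` gives `2 ^ 2 ^ l` elements with distinct actions on
-- level `l + m` (`exists_independent`). For `l = n - m` they lie in distinct cosets of `H`, which
-- bounds the index. For `l = n + 1` they lie in `H`; but `H` fixes level `n`, so on `ZMod 2`-valued
-- functions on level `n + m + 1` it acts unipotently, of class at most `2 ^ (m + 1)`, independent
-- of `n`. Such a group has few elements unless it has many generators (`card_le_of_generators`), so
-- `d(H)` is at least exponential in `n`.

namespace Grigorchuk

-- Permutations grafted below a vertex

/-- The word map applying `f` below the vertex `v` and fixing every other vertex. -/
def graftFun (v : List Bool) (f : List Bool → List Bool) (u : List Bool) : List Bool :=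
  if v <+: u then v ++ f (u.drop v.length) else u

theorem graftFun_append (v : List Bool) (f : List Bool → List Bool) (w : List Bool) :
    graftFun v f (v ++ w) = v ++ f w := by
  simp [graftFun]

theorem graftFun_of_not_prefix {v u : List Bool} (f : List Bool → List Bool) (h : ¬ v <+: u) :
    graftFun v f u = u := by
  simp [graftFun, h]

theorem graftFun_comp (v : List Bool) (f g : List Bool → List Bool) (u : List Bool) :
    graftFun v f (graftFun v g u) = graftFun v (f ∘ g) u := by
  by_cases h : v <+: u
  · obtain ⟨w, rfl⟩ := h
    simp only [graftFun_append, Function.comp]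
  · simp only [graftFun_of_not_prefix _ h]

theorem graftFun_id (v u : List Bool) : graftFun v id u = u := by
  by_cases h : v <+: u
  · obtain ⟨w, rfl⟩ := h
    simp only [graftFun_append, id]
  · simp only [graftFun_of_not_prefix _ h]

/-- The copy of a permutation acting below the vertex `v`. -/
def graft (v : List Bool) : Equiv.Perm (List Bool) →* Equiv.Perm (List Bool) where
  toFun g :=
    { toFun := graftFun v g
      invFun := graftFun v g.symm
      left_inv := fun u => by rw [graftFun_comp]; simp [graftFun_id]
      right_inv := fun u => by rw [graftFun_comp]; simp [graftFun_id] }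
  map_one' := by ext1 u; exact graftFun_id v u
  map_mul' g h := by ext1 u; exact (graftFun_comp v g h u).symm

@[simp] theorem graft_append (v : List Bool) (g : Equiv.Perm (List Bool)) (w : List Bool) :
    graft v g (v ++ w) = v ++ g w := graftFun_append v g w

theorem graft_of_not_prefix {v u : List Bool} (g : Equiv.Perm (List Bool)) (h : ¬ v <+: u) :
    graft v g u = u := graftFun_of_not_prefix g h

theorem graft_append_of_ne {v u : List Bool} (g : Equiv.Perm (List Bool))
    (hl : v.length = u.length) (h : v ≠ u) (w : List Bool) : graft v g (u ++ w) = u ++ w := by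
  apply graft_of_not_prefix
  rintro ⟨x, hx⟩
  exact h (List.append_inj hx hl).1

theorem graft_nil (g : Equiv.Perm (List Bool)) : graft [] g = g := by
  ext1 u; exact graft_append [] g u

theorem graft_graft (v u : List Bool) (g : Equiv.Perm (List Bool)) :
    graft v (graft u g) = graft (v ++ u) g := by
  ext1 x
  by_cases h : v <+: x
  · obtain ⟨w, rfl⟩ := h
    rw [graft_append]
    by_cases h' : u <+: w
    · obtain ⟨w, rfl⟩ := h'
      rw [graft_append, ← List.append_assoc, ← List.append_assoc, graft_append]
    · rw [graft_of_not_prefix _ h', graft_of_not_prefix]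
      simpa [List.prefix_append_right_inj] using h'
  · rw [graft_of_not_prefix _ h, graft_of_not_prefix]
    exact fun h' => h ((List.prefix_append v u).trans h')

theorem graft_injective (v : List Bool) : Function.Injective (graft v) := by
  intro g h hgh
  ext1 w
  have := congrArg (fun p : Equiv.Perm (List Bool) => p (v ++ w)) hgh
  simpa using this

theorem graft_commute {v u : List Bool} (hl : v.length = u.length) (h : v ≠ u)
    (g k : Equiv.Perm (List Bool)) : Commute (graft v g) (graft u k) := by
  change _ * _ = _ * _
  ext1 x
  simp only [Equiv.Perm.mul_apply]
  by_cases hv : v <+: x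
  · obtain ⟨w, rfl⟩ := hv
    rw [graft_append_of_ne k hl.symm h.symm, graft_append, graft_append_of_ne k hl.symm h.symm]
  · rw [graft_of_not_prefix _ hv]
    by_cases hu : u <+: x
    · obtain ⟨w, rfl⟩ := hu
      rw [graft_append, graft_append_of_ne g hl h]
    · rw [graft_of_not_prefix _ hu, graft_of_not_prefix _ hv]

/-- Conjugating a grafted permutation moves the graft and conjugates by the section. -/
theorem conj_graft {g h : Equiv.Perm (List Bool)} {v : List Bool}
    (hs : ∀ w, g (v ++ w) = g v ++ h w) (k : Equiv.Perm (List Bool)) :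
    g * graft v k * g⁻¹ = graft (g v) (h * k * h⁻¹) := by
  rw [mul_inv_eq_iff_eq_mul]
  ext1 x
  simp only [Equiv.Perm.mul_apply]
  by_cases hv : v <+: x
  · obtain ⟨w, rfl⟩ := hv
    rw [graft_append, hs, hs, graft_append]
    simp
  · rw [graft_of_not_prefix _ hv, graft_of_not_prefix]
    rintro ⟨w, hw⟩
    apply hv
    refine ⟨h⁻¹ w, g.injective ?_⟩
    rw [hs]; simpa using hw

-- Sections and the action on levels

theorem exists_section_bcd (v : List Bool) :
    (∃ h ∈ GrigorchukGroup, ∀ w, bFun (v ++ w) = bFun v ++ h w) ∧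
    (∃ h ∈ GrigorchukGroup, ∀ w, cFun (v ++ w) = cFun v ++ h w) ∧
    (∃ h ∈ GrigorchukGroup, ∀ w, dFun (v ++ w) = dFun v ++ h w) := by
  have ha : a ∈ GrigorchukGroup := Subgroup.subset_closure (by simp)
  have hb : b ∈ GrigorchukGroup := Subgroup.subset_closure (by simp)
  have hc : c ∈ GrigorchukGroup := Subgroup.subset_closure (by simp)
  have hd : d ∈ GrigorchukGroup := Subgroup.subset_closure (by simp)
  have haS : ∀ v, ∃ h ∈ GrigorchukGroup, ∀ w, aFun (v ++ w) = aFun v ++ h w := by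
    intro v
    cases v with
    | nil => exact ⟨a, ha, fun w => rfl⟩
    | cons x v => exact ⟨1, one_mem _, fun w => by simp [aFun]⟩
  induction v with
  | nil => exact ⟨⟨b, hb, fun w => by simp [bFun]; rfl⟩, ⟨c, hc, fun w => by simp [cFun]; rfl⟩,
      ⟨d, hd, fun w => by simp [dFun]; rfl⟩⟩
  | cons x v ih =>
    obtain ⟨⟨hb, hb1, hb2⟩, ⟨hc, hc1, hc2⟩, ⟨hd, hd1, hd2⟩⟩ := ih
    obtain ⟨h, h1, h2⟩ := haS v
    cases x
    · exact ⟨⟨h, h1, fun w => by simp [bFun, h2]⟩, ⟨h, h1, fun w => by simp [cFun, h2]⟩,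
        ⟨1, one_mem _, fun w => by simp [dFun]⟩⟩
    · exact ⟨⟨hc, hc1, fun w => by simp [bFun, hc2]⟩, ⟨hd, hd1, fun w => by simp [cFun, hd2]⟩,
        ⟨hb, hb1, fun w => by simp [dFun, hb2]⟩⟩

theorem exists_section {g : Equiv.Perm (List Bool)} (hg : g ∈ GrigorchukGroup) :
    ∀ v, ∃ h ∈ GrigorchukGroup, ∀ w, g (v ++ w) = g v ++ h w := by
  induction hg using Subgroup.closure_induction with
  | mem x hx =>
    intro v
    rcases hx with rfl | rfl | rfl | rfl
    · cases v with
      | nil => exact ⟨a, Subgroup.subset_closure (by simp), fun w => rfl⟩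
      | cons x v => exact ⟨1, one_mem _, fun w => by simp [a, aFun]⟩
    · exact (exists_section_bcd v).1
    · exact (exists_section_bcd v).2.1
    · exact (exists_section_bcd v).2.2
  | one => exact fun v => ⟨1, one_mem _, fun w => rfl⟩
  | mul x y _ _ hx hy =>
    intro v
    obtain ⟨h, h1, h2⟩ := hy v
    obtain ⟨k, k1, k2⟩ := hx (y v)
    exact ⟨k * h, mul_mem k1 h1, fun w => by simp [h2, k2]⟩
  | inv x _ hx =>
    intro v
    obtain ⟨h, h1, h2⟩ := hx (x⁻¹ v)
    refine ⟨h⁻¹, inv_mem h1, fun w => x.injective ?_⟩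
    rw [h2]; simp

theorem length_bcd (w : List Bool) :
    (bFun w).length = w.length ∧ (cFun w).length = w.length ∧ (dFun w).length = w.length := by
  have ha : ∀ w, (aFun w).length = w.length := fun w => by cases w <;> simp [aFun]
  induction w with
  | nil => simp [bFun, cFun, dFun]
  | cons x w ih => cases x <;> simp [bFun, cFun, dFun, ha, ih]

theorem length_apply (g : GrigorchukGroup) : ∀ w, (g.1 w).length = w.length := by
  obtain ⟨g, hg⟩ := g
  induction hg using Subgroup.closure_induction with
  | mem x hx =>
    intro w
    rcases hx with rfl | rfl | rfl | rfl
    · cases w <;> simp [a, aFun]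
    · exact (length_bcd w).1
    · exact (length_bcd w).2.1
    · exact (length_bcd w).2.2
  | one => exact fun w => rfl
  | mul x y _ _ hx hy => exact fun w => (hx (y w)).trans (hy w)
  | inv x _ hx => exact fun w => by simpa using (hx (x⁻¹ w)).symm

/-- The section of an element of the Grigorchuk group at a vertex. -/
noncomputable def sect (g : GrigorchukGroup) (v : List Bool) : GrigorchukGroup :=
  ⟨(exists_section g.2 v).choose, (exists_section g.2 v).choose_spec.1⟩

theorem apply_append (g : GrigorchukGroup) (v w : List Bool) :
    g.1 (v ++ w) = g.1 v ++ (sect g v).1 w :=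
  (exists_section g.2 v).choose_spec.2 w

theorem ext_of_append {g h : GrigorchukGroup} (n : ℕ)
    (H : ∀ v w : List Bool, v.length = n → g.1 (v ++ w) = h.1 (v ++ w)) : g = h := by
  have key : ∀ v w : List Bool, g.1 (v ++ w) = h.1 (v ++ w) → g.1 v = h.1 v := by
    intro v w hvw
    rw [apply_append, apply_append] at hvw
    exact (List.append_inj hvw (by simp [length_apply])).1
  apply Subtype.ext
  ext1 u
  -- Padding makes the word long enough to have a prefix of length `n`, even when `u` is short.
  apply key u (List.replicate n false)
  rw [← List.take_append_drop n (u ++ List.replicate n false)]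
  exact H _ _ (by simp)

/-- The generators as elements of the group. -/
def genA : GrigorchukGroup := ⟨a, Subgroup.subset_closure (by simp)⟩
/-- The generator `b` as an element of the group. -/
def genB : GrigorchukGroup := ⟨b, Subgroup.subset_closure (by simp)⟩
/-- The generator `c` as an element of the group. -/
def genC : GrigorchukGroup := ⟨c, Subgroup.subset_closure (by simp)⟩
/-- The generator `d` as an element of the group. -/
def genD : GrigorchukGroup := ⟨d, Subgroup.subset_closure (by simp)⟩

theorem closure_gens : Subgroup.closure {genA, genB, genC, genD} = ⊤ := by
  rw [eq_top_iff]
  rintro ⟨g, hg⟩ -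
  induction hg using Subgroup.closure_induction with
  | mem x hx =>
    rcases hx with rfl | rfl | rfl | rfl
    · exact Subgroup.subset_closure (Or.inl rfl)
    · exact Subgroup.subset_closure (Or.inr (Or.inl rfl))
    · exact Subgroup.subset_closure (Or.inr (Or.inr (Or.inl rfl)))
    · exact Subgroup.subset_closure (Or.inr (Or.inr (Or.inr rfl)))
  | one => exact one_mem _
  | mul x y hx hy h1 h2 => exact mul_mem h1 h2
  | inv x hx h => exact inv_mem h

-- Self-replication, transitivity on levels, infinitude

@[simp] theorem a_nil : a [] = [] := rfl
@[simp] theorem b_nil : b [] = [] := by change bFun _ = _; simp [bFun]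
@[simp] theorem c_nil : c [] = [] := by change cFun _ = _; simp [cFun]
@[simp] theorem d_nil : d [] = [] := by change dFun _ = _; simp [dFun]
@[simp] theorem a_cons (x : Bool) (w : List Bool) : a (x :: w) = (!x) :: w := rfl
@[simp] theorem b_false (w : List Bool) : b (false :: w) = false :: a w := by
  change bFun _ = _ :: aFun _; simp [bFun]
@[simp] theorem b_true (w : List Bool) : b (true :: w) = true :: c w := by
  change bFun _ = _ :: cFun _; simp [bFun]
@[simp] theorem c_false (w : List Bool) : c (false :: w) = false :: a w := by
  change cFun _ = _ :: aFun _; simp [cFun]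
@[simp] theorem c_true (w : List Bool) : c (true :: w) = true :: d w := by
  change cFun _ = _ :: dFun _; simp [cFun]
@[simp] theorem d_false (w : List Bool) : d (false :: w) = false :: w := by
  change dFun _ = _; simp [dFun]
@[simp] theorem d_true (w : List Bool) : d (true :: w) = true :: b w := by
  change dFun _ = _ :: bFun _; simp [dFun]

/-- Every element of the group occurs as the section, at a given child of the root, of an element
fixing that child. -/
theorem exists_lift_cons (x : Bool) (h : GrigorchukGroup) :
    ∃ g : GrigorchukGroup, ∀ w, g.1 (x :: w) = x :: h.1 w := by
  have hh : h ∈ Subgroup.closure {genA, genB, genC, genD} := closure_gens ▸ Subgroup.mem_top h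
  have key : ∃ g : GrigorchukGroup, ∀ w, g.1 (true :: w) = true :: h.1 w := by
    induction hh using Subgroup.closure_induction with
    | mem y hy =>
      rcases hy with rfl | rfl | rfl | rfl
      -- At the child `true`, the elements `aba`, `d`, `b`, `c` have the sections `a`, `b`, `c`,
      -- `d`.
      · exact ⟨genA * genB * genA, fun w => by simp [genA, genB]⟩
      · exact ⟨genD, fun w => by simp [genB, genD]⟩
      · exact ⟨genB, fun w => by simp [genB, genC]⟩
      · exact ⟨genC, fun w => by simp [genC, genD]⟩
    | one => exact ⟨1, fun w => rfl⟩
    | mul y z _ _ hy hz =>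
      obtain ⟨g, hg⟩ := hy
      obtain ⟨k, hk⟩ := hz
      exact ⟨g * k, fun w => by simp [hg, hk]⟩
    | inv y _ hy =>
      obtain ⟨g, hg⟩ := hy
      refine ⟨g⁻¹, fun w => g.1.injective ?_⟩
      rw [hg]; simp
  cases x
  · obtain ⟨g, hg⟩ := key
    refine ⟨genA * g * genA, fun w => ?_⟩
    have : ∀ w, genA.1 (false :: w) = true :: w := fun w => rfl
    have h' : ∀ w, genA.1 (true :: w) = false :: w := fun w => rfl
    simp [this, hg, h']
  · exact key

theorem exists_apply_eq : ∀ u v : List Bool, u.length = v.length →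
    ∃ g : GrigorchukGroup, g.1 u = v := by
  intro u
  induction u with
  | nil => intro v hv; exact ⟨1, by cases v <;> simp_all⟩
  | cons x u ih =>
    intro v hv
    cases v with
    | nil => simp at hv
    | cons y v =>
      obtain ⟨g, hg⟩ := ih v (by simpa using hv)
      obtain ⟨k, hk⟩ := exists_lift_cons y g
      by_cases hxy : x = y
      · subst hxy; exact ⟨k, by rw [hk, hg]⟩
      · refine ⟨k * genA, ?_⟩
        have : genA.1 (x :: u) = y :: u := by
          cases x <;> cases y <;> simp_all [genA, a, aFun]
        simp [this, hk, hg]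

/-- Transitivity on level `n` forces at least `2 ^ n` elements. -/
theorem infinite_grigorchukGroup : Infinite GrigorchukGroup := by
  rw [← not_finite_iff_infinite]
  intro hfin
  have key : ∀ n : ℕ, 2 ^ n ≤ Nat.card GrigorchukGroup := by
    intro n
    choose f hf using fun v : List.Vector Bool n =>
      exists_apply_eq (List.replicate n false) v.1 (by simp [v.2])
    have := Nat.card_le_card_of_injective f (fun u v huv => Subtype.ext (by rw [← hf, huv, hf]))
    simpa [Nat.card_eq_fintype_card, card_vector] using this
  exact absurd (key _) (not_le.mpr (Nat.lt_two_pow_self))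

-- Relations between the generators

@[simp] theorem a_a (w : List Bool) : a (a w) = w := aFun_involutive w
@[simp] theorem b_b (w : List Bool) : b (b w) = w := (bcdFun_involutive w).1
@[simp] theorem c_c (w : List Bool) : c (c w) = w := (bcdFun_involutive w).2.1
@[simp] theorem d_d (w : List Bool) : d (d w) = w := (bcdFun_involutive w).2.2

theorem bcd_apply (w : List Bool) :
    b (c w) = d w ∧ c (d w) = b w ∧ d (b w) = c w := by
  induction w with
  | nil => simp
  | cons x w ih => cases x <;> simp [ih]

theorem genA_mul_self : genA * genA = 1 := by ext1; ext1 w; exact a_a w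
theorem genB_mul_self : genB * genB = 1 := by ext1; ext1 w; exact b_b w
theorem genC_mul_self : genC * genC = 1 := by ext1; ext1 w; exact c_c w
theorem genD_mul_self : genD * genD = 1 := by ext1; ext1 w; exact d_d w

theorem genD_mul_genB : genD * genB = genC := by ext1; ext1 w; exact (bcd_apply w).2.2

theorem ad_pow_four_apply (w : List Bool) : a (d (a (d (a (d (a (d w))))))) = w := by
  match w with
  | [] => simp
  | false :: w => simp
  | true :: w => simp

theorem genA_genD_pow_four : (genA * genD) ^ 4 = 1 := by
  ext1; ext1 w
  exact ad_pow_four_apply w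

theorem da_pow_four_apply (w : List Bool) : d (a (d (a (d (a (d (a w))))))) = w := by
  have := ad_pow_four_apply (a w)
  simpa using congrArg a this

theorem ac_pow_eight_apply (w : List Bool) :
    a (c (a (c (a (c (a (c (a (c (a (c (a (c (a (c w))))))))))))))) = w := by
  match w with
  | [] => simp
  | false :: w => simp [da_pow_four_apply]
  | true :: w => simp [ad_pow_four_apply]

theorem ca_pow_eight_apply (w : List Bool) :
    c (a (c (a (c (a (c (a (c (a (c (a (c (a (c (a w))))))))))))))) = w := by
  have := ac_pow_eight_apply (a w)
  simpa using congrArg a this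

/-- The element `(ab)²`. -/
def abSq : GrigorchukGroup := (genA * genB) ^ 2

/-- Orders double from level to level: the sections of `(ad)²` are `b`, those of `(ac)²` are `da`
and `ad`, those of `(ab)²` are `ca` and `ac`. -/
theorem abSq_pow_eight : abSq ^ 8 = 1 := by
  rw [abSq, ← pow_mul]
  ext1; ext1 w
  change a (b (a (b (a (b (a (b (a (b (a (b (a (b (a (b (a (b (a (b (a (b (a (b (a (b (a (b (a (b
    (a (b w))))))))))))))))))))))))))))))) = w
  match w with
  | [] => simp
  | false :: w => simp [ca_pow_eight_apply]
  | true :: w => simp [ac_pow_eight_apply]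

-- The branching subgroup and its commutator subgroup have finite index

/-- The normal closure of `(ab)²`, the branching subgroup of the Grigorchuk group. -/
def branchSubgroup : Subgroup GrigorchukGroup := Subgroup.normalClosure {abSq}

instance : branchSubgroup.Normal := Subgroup.normalClosure_normal

theorem abSq_mem : abSq ∈ branchSubgroup := Subgroup.subset_normalClosure rfl

theorem finite_of_mul_mem {Q : Type*} [Group Q] {S F : Set Q} (hS : Subgroup.closure S = ⊤)
    (hinv : ∀ s ∈ S, s⁻¹ = s) (hF : F.Finite) (h1 : 1 ∈ F)
    (hmul : ∀ s ∈ S, ∀ x ∈ F, s * x ∈ F) : Finite Q := by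
  have : ∀ x : Q, x ∈ F := by
    intro x
    have hx : x ∈ Subgroup.closure S := hS ▸ Subgroup.mem_top x
    induction hx using Subgroup.closure_induction_left with
    | one => exact h1
    | mul_left s hs y _ hy => exact hmul s hs y hy
    | inv_mul_cancel s hs y _ hy => rw [hinv s hs]; exact hmul s hs y hy
  exact Set.finite_univ_iff.mp (hF.subset fun x _ => this x)

/-- Killing `(ab)²` makes `b` central, `c = db` is redundant, and `a`, `d` generate a dihedral
group; hence the products `b ^ i * (a * d) ^ j * a ^ k` exhaust the group. -/
theorem finite_of_relations {Q : Type*} [Group Q] (a b c d : Q)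
    (hS : Subgroup.closure {a, b, c, d} = ⊤) (ha : a * a = 1) (hb : b * b = 1) (hc : c * c = 1)
    (hd : d * d = 1) (hdb : d * b = c) (had : (a * d) ^ 4 = 1)
    (hab : (a * b) ^ 2 = 1) : Finite Q := by
  have ha' : a⁻¹ = a := inv_eq_of_mul_eq_one_left ha
  have hb' : b⁻¹ = b := inv_eq_of_mul_eq_one_left hb
  have hc' : c⁻¹ = c := inv_eq_of_mul_eq_one_left hc
  have hd' : d⁻¹ = d := inv_eq_of_mul_eq_one_left hd
  have cab : Commute a b := by
    have : a * b = (a * b)⁻¹ := eq_inv_of_mul_eq_one_left (by rw [← sq, hab])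
    rw [mul_inv_rev, ha', hb'] at this
    exact this
  have cdb : Commute d b := by
    have : d * b = (d * b)⁻¹ := by rw [hdb, hc']
    rw [mul_inv_rev, hd', hb'] at this
    exact this
  let F : Set Q := Set.image2 (fun x y => x * y)
    (Set.image2 (fun x y => x * y) (Subgroup.zpowers b) (Subgroup.zpowers (a * d)))
    (Subgroup.zpowers a)
  have fin : ∀ (x : Q) (n : ℕ), x ^ n = 1 → 0 < n →
      ((Subgroup.zpowers x : Subgroup Q) : Set Q).Finite :=
    fun x n h hn => finite_zpowers.mpr (isOfFinOrder_iff_pow_eq_one.mpr ⟨n, hn, h⟩)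
  have hF : F.Finite := ((fin b 2 (by rw [sq, hb]) (by norm_num)).image2 _
    (fin _ 4 had (by norm_num))).image2 _ (fin a 2 (by rw [sq, ha]) (by norm_num))
  have memF : ∀ x, x ∈ F ↔ ∃ i j k : ℤ, b ^ i * (a * d) ^ j * a ^ k = x := by
    intro x
    simp only [F, Set.mem_image2, SetLike.mem_coe, Subgroup.mem_zpowers_iff]
    constructor
    · rintro ⟨_, ⟨_, ⟨i, rfl⟩, _, ⟨j, rfl⟩, rfl⟩, _, ⟨k, rfl⟩, rfl⟩
      exact ⟨i, j, k, rfl⟩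
    · rintro ⟨i, j, k, rfl⟩
      exact ⟨_, ⟨_, ⟨i, rfl⟩, _, ⟨j, rfl⟩, rfl⟩, _, ⟨k, rfl⟩, rfl⟩
  have hmA : ∀ x ∈ F, a * x ∈ F := by
    simp only [memF]
    rintro _ ⟨i, j, k, rfl⟩
    refine ⟨i, -j, k + 1, ?_⟩
    have h1 : a * (a * d) ^ j * a⁻¹ = (a * d) ^ (-j) := by
      rw [← conj_zpow, zpow_neg, ← inv_zpow]
      congr 1
      rw [mul_inv_rev, ha', hd', ← mul_assoc, ha, one_mul]
    rw [← h1, zpow_add, zpow_one, ((Commute.refl a).zpow_right k).eq.symm]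
    have h2 := (cab.zpow_right i).eq
    simp only [← mul_assoc]
    rw [h2]
    simp only [mul_assoc, inv_mul_cancel_left]
  have hmB : ∀ x ∈ F, b * x ∈ F := by
    simp only [memF]
    rintro _ ⟨i, j, k, rfl⟩
    exact ⟨1 + i, j, k, by rw [zpow_add, zpow_one]; simp only [mul_assoc]⟩
  have hmD : ∀ x ∈ F, d * x ∈ F := by
    intro x hx
    have h2 := hmA x hx
    rw [memF] at h2 ⊢
    obtain ⟨i, j, k, h⟩ := h2
    refine ⟨i, -1 + j, k, ?_⟩
    have h1 : Commute (a * d) b := cab.mul_left cdb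
    rw [zpow_add, zpow_neg_one, ← mul_assoc, (h1.inv_left.zpow_right i).eq.symm, mul_assoc,
      mul_assoc, ← mul_assoc (b ^ i), h, mul_inv_rev, ha', hd', mul_assoc, ← mul_assoc a a, ha,
      one_mul]
  refine finite_of_mul_mem hS ?_ hF ?_ ?_
  · rintro s (rfl | rfl | rfl | rfl) <;> assumption
  · rw [memF]; exact ⟨0, 0, 0, by simp⟩
  · rintro s (rfl | rfl | rfl | rfl) x hx
    · exact hmA x hx
    · exact hmB x hx
    · rw [← hdb, mul_assoc]; exact hmD _ (hmB x hx)
    · exact hmD x hx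

instance : branchSubgroup.FiniteIndex := by
  have key : Finite (GrigorchukGroup ⧸ branchSubgroup) := by
    let π := QuotientGroup.mk' branchSubgroup
    refine finite_of_relations (π genA) (π genB) (π genC) (π genD) ?_ ?_ ?_ ?_ ?_ ?_ ?_ ?_
    · have := congrArg (Subgroup.map π) closure_gens
      rw [MonoidHom.map_closure, Subgroup.map_top_of_surjective _ (QuotientGroup.mk'_surjective _)]
        at this
      simpa [Set.image_insert_eq] using this
    · rw [← map_mul, genA_mul_self, map_one]
    · rw [← map_mul, genB_mul_self, map_one]
    · rw [← map_mul, genC_mul_self, map_one]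
    · rw [← map_mul, genD_mul_self, map_one]
    · rw [← map_mul, genD_mul_genB]
    · rw [← map_mul, ← map_pow, genA_genD_pow_four, map_one]
    · rw [← map_mul, ← map_pow]
      exact (QuotientGroup.eq_one_iff _).mpr abSq_mem
  exact Subgroup.finiteIndex_of_finite_quotient

theorem finite_abelianization_of_pow {X : Type*} [Group X] [Group.FG X] {S : Set X}
    (hS : Subgroup.closure S = ⊤) {n : ℕ} (hn : 0 < n) (h : ∀ s ∈ S, s ^ n = 1) :
    Finite (Abelianization X) := by
  have hfg : Group.FG (Abelianization X) :=
    inferInstanceAs (Group.FG (X ⧸ commutator X))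
  have key : ∀ x : X, (Abelianization.of x) ^ n = 1 := by
    intro x
    have hx : x ∈ Subgroup.closure S := hS ▸ Subgroup.mem_top x
    induction hx using Subgroup.closure_induction with
    | mem x hx => rw [← map_pow, h x hx, map_one]
    | one => simp
    | mul x y _ _ hx hy => rw [map_mul, mul_pow, hx, hy, one_mul]
    | inv x _ hx => rw [map_inv, inv_pow, hx, inv_one]
  refine CommGroup.finite_of_fg_isMulTorsion _ ?_
  intro x
  obtain ⟨y, rfl⟩ := QuotientGroup.mk_surjective x
  exact isOfFinOrder_iff_pow_eq_one.mpr ⟨n, hn, key y⟩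

instance : (commutator branchSubgroup).FiniteIndex := by
  have : Finite (Abelianization branchSubgroup) := by
    -- The branching subgroup is generated by conjugates of `(ab)²`, whose eighth powers are
    -- trivial.
    refine finite_abelianization_of_pow (S := {s | s ^ 8 = 1}) ?_ (n := 8) (by norm_num)
      (fun s hs => hs)
    rw [eq_top_iff]
    rintro ⟨x, hx⟩ -
    have h2 : x ∈ (Subgroup.closure {s : branchSubgroup | s ^ 8 = 1}).map branchSubgroup.subtype := by
      rw [MonoidHom.map_closure]
      rw [branchSubgroup, Subgroup.normalClosure] at hx
      refine Subgroup.closure_mono ?_ hx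
      intro y hy
      rw [Group.mem_conjugatesOfSet_iff] at hy
      obtain ⟨z, rfl, hz⟩ := hy
      obtain ⟨g, rfl⟩ := isConj_iff.mp hz
      refine ⟨⟨_, (inferInstance : branchSubgroup.Normal).conj_mem _ abSq_mem g⟩, ?_, rfl⟩
      ext1
      change (g * abSq * g⁻¹) ^ 8 = 1
      simp [abSq_pow_eight, conj_pow]
    obtain ⟨y, hy, rfl⟩ := h2
    exact hy
  have : Finite (branchSubgroup ⧸ commutator branchSubgroup) := this
  exact Subgroup.finiteIndex_of_finite_quotient

-- Copies of the branching subgroup below vertices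

open scoped commutatorElement

theorem graft_singleton_abSq (x : Bool) :
    ∃ k ∈ branchSubgroup, k.1 = graft [x] abSq.1 := by
  have hn : branchSubgroup.Normal := inferInstance
  -- At `false` the sections `ca` and `ac` of the two factors cancel; at `true` they are `ac` and
  -- `dab`, and `cd = b` turns their product into `abab`.
  have key : abSq * (genC * abSq * genC⁻¹) ∈ branchSubgroup :=
    mul_mem abSq_mem (hn.conj_mem _ abSq_mem _)
  have hc : genC⁻¹ = genC := inv_eq_of_mul_eq_one_left genC_mul_self
  have htrue : (abSq * (genC * abSq * genC⁻¹)).1 = graft [true] abSq.1 := by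
    rw [hc]
    ext1 w
    change a (b (a (b (c (a (b (a (b (c w))))))))) = _
    match w with
    | [] => rw [graft_of_not_prefix _ (by simp)]; simp
    | false :: w => rw [graft_of_not_prefix _ (by simp)]; simp
    | true :: w =>
      change _ = graft [true] abSq.1 ([true] ++ w)
      rw [graft_append]
      change _ = true :: (a (b (a (b w))))
      have h1 : ∀ w, c (d w) = b w := fun w => (bcd_apply w).2.1
      simp [h1]
  cases x
  · refine ⟨_, hn.conj_mem _ key genA, ?_⟩
    change genA.1 * (abSq * (genC * abSq * genC⁻¹)).1 * genA.1⁻¹ = _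
    rw [htrue, conj_graft (h := 1) (fun w => by rfl)]
    simp [genA]
  · exact ⟨_, key, htrue⟩

/-- The elements whose graft lies in the branching subgroup form a normal subgroup: conjugation by
`g` is realised below `x` by an element fixing `x` with section `g`. So it suffices to graft
`(ab)²`. -/
theorem exists_graft_singleton (x : Bool) {k : GrigorchukGroup} (hk : k ∈ branchSubgroup) :
    ∃ k' ∈ branchSubgroup, k'.1 = graft [x] k.1 := by
  let M : Subgroup GrigorchukGroup := (branchSubgroup.map GrigorchukGroup.subtype).comap
    ((graft [x]).comp GrigorchukGroup.subtype)
  have hM : ∀ m, m ∈ M ↔ ∃ k' ∈ branchSubgroup, k'.1 = graft [x] m.1 := fun m => Iff.rfl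
  have hn : M.Normal := by
    refine ⟨fun m hm g => ?_⟩
    rw [hM] at hm ⊢
    obtain ⟨k', hk', h⟩ := hm
    obtain ⟨l, hl⟩ := exists_lift_cons x g
    refine ⟨l * k' * l⁻¹, (inferInstance : branchSubgroup.Normal).conj_mem _ hk' l, ?_⟩
    change l.1 * k'.1 * l.1⁻¹ = _
    have hlx : l.1 [x] = [x] := by
      have := hl []
      have h2 : g.1 [] = [] := List.length_eq_zero_iff.mp (length_apply g [])
      rw [this, h2]
    rw [h, conj_graft (h := g.1) (fun w => by rw [hlx]; exact hl w), hlx]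
    rfl
  exact (hM k).mp (Subgroup.normalClosure_le_normal
    (Set.singleton_subset_iff.mpr ((hM _).mpr (graft_singleton_abSq x))) hk)

theorem exists_graft (v : List Bool) {k : GrigorchukGroup} (hk : k ∈ branchSubgroup) :
    ∃ k' ∈ branchSubgroup, k'.1 = graft v k.1 := by
  induction v with
  | nil => exact ⟨k, hk, (graft_nil _).symm⟩
  | cons x v ih =>
    obtain ⟨k', h1, h2⟩ := ih
    obtain ⟨k'', h3, h4⟩ := exists_graft_singleton x h1
    exact ⟨k'', h3, by rw [h4, h2, graft_graft]; rfl⟩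

/-- The embedding of the branching subgroup below the vertex `v`. -/
def branch (v : List Bool) : branchSubgroup →* GrigorchukGroup :=
  ((graft v).comp (GrigorchukGroup.subtype.comp branchSubgroup.subtype)).codRestrict _ (by
    intro k
    obtain ⟨k', -, h⟩ := exists_graft v k.2
    change graft v k.1.1 ∈ _
    rw [← h]
    exact k'.2)

theorem branch_val (v : List Bool) (k : branchSubgroup) : (branch v k).1 = graft v k.1.1 := rfl

theorem branch_injective (v : List Bool) : Function.Injective (branch v) := by
  intro k l h
  have := congrArg Subtype.val h
  rw [branch_val, branch_val] at this
  exact Subtype.ext (Subtype.ext (graft_injective v this))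

theorem branch_append (v : List Bool) (k : branchSubgroup) (w : List Bool) :
    (branch v k).1 (v ++ w) = v ++ k.1.1 w := graft_append _ _ _

theorem branch_append_of_ne {v u : List Bool} (k : branchSubgroup) (hl : v.length = u.length)
    (h : v ≠ u) (w : List Bool) : (branch v k).1 (u ++ w) = u ++ w :=
  graft_append_of_ne _ hl h w

theorem branch_commute {v u : List Bool} (hl : v.length = u.length) (h : v ≠ u)
    (k l : branchSubgroup) : Commute (branch v k) (branch u l) :=
  Subtype.ext (graft_commute hl h _ _)

theorem conj_branch (g : GrigorchukGroup) (v : List Bool) (k : branchSubgroup) :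
    g * branch v k * g⁻¹ =
      branch (g.1 v) (MulAut.conjNormal (sect g v) k) := by
  ext1
  exact conj_graft (fun w => apply_append g v w) _

-- Copies of the commutator subgroup inside a normal subgroup

/-- The subgroup generated by the copies of the commutator subgroup of the branching subgroup below
the vertices of level `k`. -/
def levelSubgroup (k : ℕ) : Subgroup GrigorchukGroup :=
  ⨆ v : List.Vector Bool k, (commutator branchSubgroup).map (branch v.1)

theorem branch_mem_levelSubgroup {k : ℕ} (v : List.Vector Bool k) {l : branchSubgroup}
    (hl : l ∈ commutator branchSubgroup) : branch v.1 l ∈ levelSubgroup k :=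
  Subgroup.mem_iSup_of_mem v ⟨l, hl, rfl⟩

/-- A normal subgroup with an element fixing a vertex and swapping its children contains the copies
of the commutator subgroup of the branching subgroup on the next level. -/
theorem levelSubgroup_le {H : Subgroup GrigorchukGroup} [hH : H.Normal] {g : GrigorchukGroup}
    (hg : g ∈ H) {k : ℕ} {v : List Bool} (hv : v.length = k) (hgv : g.1 v ≠ v) :
    levelSubgroup k ≤ H := by
  have hlen : (g.1 v).length = v.length := length_apply g v
  have h1 : ∀ x y : branchSubgroup, branch v ⁅x, y⁆ ∈ H := by
    intro x y
    -- A commutator of `g` with an element supported below `v` splits into a part below `g v` and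
    -- `branch v x`.
    have hz : g * (branch v x⁻¹ * g⁻¹ * (branch v x⁻¹)⁻¹) ∈ H :=
      mul_mem hg (hH.conj_mem _ (inv_mem hg) _)
    obtain ⟨x', hx'⟩ : ∃ x' : branchSubgroup, g * (branch v x⁻¹ * g⁻¹ * (branch v x⁻¹)⁻¹) =
        branch (g.1 v) x' * branch v x :=
      ⟨_, by rw [← mul_assoc, ← mul_assoc, conj_branch, map_inv (branch v), inv_inv]⟩
    rw [hx'] at hz
    have hc : ∀ y, Commute (branch (g.1 v) x') (branch v y) :=
      branch_commute hlen hgv x'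
    -- The part below `g v` commutes with everything below `v`, so a second commutator removes it.
    have hw := mul_mem hz (hH.conj_mem _ (inv_mem hz) (branch v y))
    convert hw using 1
    rw [map_commutatorElement, commutatorElement_def, mul_inv_rev]
    have e1 := (hc x).eq
    rw [e1]
    simp only [mul_assoc]
    rw [← mul_assoc (branch v y)]
    have e3 : Commute (branch (g.1 v) x') (branch v y * (branch v x)⁻¹) :=
      (hc y).mul_right (hc x).inv_right
    rw [← mul_assoc (branch v y), ← mul_assoc (branch (g.1 v) x'), e3.eq]
    simp [mul_assoc]
  have h2 : ∀ l ∈ commutator branchSubgroup, branch v l ∈ H := by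
    intro l hl
    have : commutator branchSubgroup ≤ H.comap (branch v) :=
      Subgroup.commutator_le.mpr fun x _ y _ => h1 x y
    exact this hl
  refine iSup_le ?_
  rintro ⟨u, hu⟩
  rw [Subgroup.map_le_iff_le_comap]
  intro l hl
  -- Conjugation by `f` carries the copy at `v` to `u`, twisted by an automorphism under which the
  -- commutator subgroup is invariant.
  obtain ⟨f, hf⟩ := exists_apply_eq v u (hv.trans hu.symm)
  let φ : branchSubgroup ≃* branchSubgroup := MulAut.conjNormal (sect f v)
  have h3 : φ.symm l ∈ commutator branchSubgroup :=
    (Subgroup.Characteristic.fixed (H := commutator branchSubgroup) inferInstance φ.symm).ge hl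
  have h4 := hH.conj_mem _ (h2 _ h3) f
  rw [conj_branch, hf] at h4
  have h5 : MulAut.conjNormal (sect f v) (φ.symm l) = l := φ.apply_symm_apply l
  rw [h5] at h4
  exact h4

theorem exists_moved_level {H : Subgroup GrigorchukGroup} (hH : H ≠ ⊥) :
    ∃ n, (∀ g ∈ H, ∀ v, v.length = n → g.1 v = v) ∧
      ∃ g ∈ H, ∃ v : List Bool, v.length = n + 1 ∧ g.1 v ≠ v := by
  obtain ⟨g, hg, hg1⟩ := H.bot_or_exists_ne_one.resolve_left hH
  obtain ⟨w, hw⟩ : ∃ w, g.1 w ≠ w := by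
    by_contra! h
    exact hg1 (Subtype.ext (Equiv.ext h))
  classical
  have hex : ∃ n, ∃ g ∈ H, ∃ v : List Bool, v.length = n ∧ g.1 v ≠ v := ⟨_, g, hg, w, rfl, hw⟩
  have hpos : Nat.find hex ≠ 0 := by
    intro h0
    obtain ⟨g, -, v, hv, hgv⟩ := Nat.find_spec hex
    rw [h0, List.length_eq_zero_iff] at hv
    subst hv
    exact hgv (List.length_eq_zero_iff.mp (length_apply g []))
  obtain ⟨n, hn⟩ := Nat.exists_eq_succ_of_ne_zero hpos
  refine ⟨n, fun g hg v hv => ?_, ?_⟩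
  · by_contra hgv
    exact Nat.find_min hex (by omega) ⟨g, hg, v, hv, hgv⟩
  · have := Nat.find_spec hex
    rwa [hn] at this

/-- Elements of the branching subgroup can be prescribed independently below the vertices of a
level. -/
theorem exists_spread {k : ℕ} (l : List.Vector Bool k → branchSubgroup) :
    ∃ g : GrigorchukGroup,
      (∀ R : Subgroup GrigorchukGroup, (∀ v, branch v.1 (l v) ∈ R) → g ∈ R) ∧
      ∀ (v : List.Vector Bool k) (w : List Bool), g.1 (v.1 ++ w) = v.1 ++ (l v).1.1 w := by
  classical
  have key : ∀ s : Finset (List.Vector Bool k), ∃ g : GrigorchukGroup,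
      (∀ R : Subgroup GrigorchukGroup, (∀ v, branch v.1 (l v) ∈ R) → g ∈ R) ∧
      ∀ (v : List.Vector Bool k) (w : List Bool),
        g.1 (v.1 ++ w) = v.1 ++ if v ∈ s then (l v).1.1 w else w := by
    intro s
    induction s using Finset.induction_on with
    | empty => exact ⟨1, fun R _ => one_mem R, fun v w => by simp⟩
    | insert u s hu ih =>
      obtain ⟨g, h1, h2⟩ := ih
      refine ⟨branch u.1 (l u) * g, fun R hR => mul_mem (hR u) (h1 R hR), fun v w => ?_⟩
      change (branch u.1 (l u)).1 (g.1 (v.1 ++ w)) = _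
      rw [h2]
      by_cases huv : v = u
      · subst huv
        rw [branch_append]
        simp [hu]
      · rw [branch_append_of_ne _ (u.2.trans v.2.symm) (fun h => huv (Subtype.ext h.symm))]
        simp [huv]
  obtain ⟨g, h1, h2⟩ := key Finset.univ
  exact ⟨g, h1, fun v w => by simpa using h2 v w⟩

-- Bounds for the index

/-- The commutator subgroup of the branching subgroup, as a subgroup of the Grigorchuk group. -/
def branchCommutator : Subgroup GrigorchukGroup :=
  (commutator branchSubgroup).map branchSubgroup.subtype

instance : branchCommutator.FiniteIndex := by
  constructor
  rw [branchCommutator, Subgroup.index_map_subtype]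
  exact mul_ne_zero Subgroup.FiniteIndex.index_ne_zero Subgroup.FiniteIndex.index_ne_zero

theorem index_le_of_forall {G X : Type*} [Group G] [Finite X] {R : Subgroup G} (f : G → X)
    (h : ∀ g g', f g = f g' → g⁻¹ * g' ∈ R) : R.index ≠ 0 ∧ R.index ≤ Nat.card X := by
  have hinj : Function.Injective (fun q : G ⧸ R => f q.out) := by
    intro q q' hq
    rw [← q.out_eq', ← q'.out_eq']
    exact QuotientGroup.eq.mpr (h _ _ hq)
  have : Finite (G ⧸ R) := Finite.of_injective _ hinj
  exact ⟨(Subgroup.finiteIndex_of_finite_quotient (H := R)).index_ne_zero,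
    Nat.card_le_card_of_injective _ hinj⟩

theorem card_le_index {G X : Type*} [Group G] {R : Subgroup G} [R.FiniteIndex] (f : X → G)
    (h : ∀ x y, (f x)⁻¹ * f y ∈ R → x = y) : Nat.card X ≤ R.index :=
  Nat.card_le_card_of_injective (fun x => (f x : G ⧸ R))
    (fun x y hxy => h x y (QuotientGroup.eq.mp hxy))

theorem index_levelSubgroup (k : ℕ) : (levelSubgroup k).index ≠ 0 ∧
    (levelSubgroup k).index ≤ (2 ^ k) ^ (2 ^ k) * branchCommutator.index ^ (2 ^ k) := by
  -- The images of the level `k` vertices, with the sections there modulo `branchCommutator`,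
  -- determine the coset of `levelSubgroup k`.
  let f : GrigorchukGroup → (List.Vector Bool k → List.Vector Bool k) ×
      (List.Vector Bool k → GrigorchukGroup ⧸ branchCommutator) := fun g =>
    (fun v => ⟨g.1 v.1, (length_apply g v.1).trans v.2⟩, fun v => (sect g v.1 : GrigorchukGroup ⧸ _))
  have := index_le_of_forall (R := levelSubgroup k) f (by
    intro g g' hg
    obtain ⟨h1, h2⟩ := Prod.ext_iff.mp hg
    have h3 : ∀ v : List.Vector Bool k, g.1 v.1 = g'.1 v.1 := fun v =>
      congrArg Subtype.val (congrFun h1 v)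
    have h4 : ∀ v : List.Vector Bool k, ∃ l ∈ commutator branchSubgroup,
        l.1 = (sect g v.1)⁻¹ * sect g' v.1 := fun v => QuotientGroup.eq.mp (congrFun h2 v)
    choose l hl hl2 using h4
    obtain ⟨s, hs1, hs2⟩ := exists_spread l
    have hs : g * s = g' := by
      refine ext_of_append k fun v w hv => ?_
      obtain ⟨v, rfl⟩ : ∃ v' : List.Vector Bool k, v'.1 = v := ⟨⟨v, hv⟩, rfl⟩
      have h5 := hs2 v w
      have h6 := h3 v
      change g.1 (s.1 (v.1 ++ w)) = _
      rw [h5, apply_append, apply_append, h6, hl2]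
      simp
    rw [← hs, inv_mul_cancel_left]
    exact hs1 _ fun v => branch_mem_levelSubgroup v (hl v))
  refine ⟨this.1, this.2.trans (le_of_eq ?_)⟩
  rw [Nat.card_prod, Nat.card_fun, Nat.card_fun, Nat.card_eq_fintype_card, card_vector,
    Fintype.card_bool, Subgroup.index]

theorem exists_mem_commutator_ne_one : ∃ k ∈ commutator branchSubgroup, k ≠ 1 := by
  by_contra! h
  have h1 : commutator branchSubgroup = ⊥ := (Subgroup.eq_bot_iff_forall _).mpr h
  have h2 : branchCommutator.index ≠ 0 := Subgroup.FiniteIndex.index_ne_zero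
  rw [branchCommutator, h1, Subgroup.map_bot, Subgroup.index_bot] at h2
  have := infinite_grigorchukGroup
  exact h2 Nat.card_eq_zero_of_infinite

theorem exists_independent : ∃ m : ℕ, ∀ n : ℕ, ∃ φ : (List.Vector Bool n → Bool) → GrigorchukGroup,
    (∀ ε, φ ε ∈ levelSubgroup n) ∧
    ∀ ε ε', (∀ w : List Bool, w.length = n + m → (φ ε).1 w = (φ ε').1 w) → ε = ε' := by
  obtain ⟨k, hk, hk1⟩ := exists_mem_commutator_ne_one
  obtain ⟨w, hw⟩ : ∃ w, k.1.1 w ≠ w := by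
    by_contra! h
    exact hk1 (Subtype.ext (Subtype.ext (Equiv.ext h)))
  refine ⟨w.length, fun n => ?_⟩
  choose φ h1 h2 using fun ε : List.Vector Bool n → Bool =>
    exists_spread (fun v => if ε v then k else 1)
  refine ⟨φ, fun ε => h1 ε _ fun v => branch_mem_levelSubgroup v ?_, fun ε ε' h => ?_⟩
  · split_ifs
    exacts [hk, one_mem _]
  · funext v
    have h3 := h (v.1 ++ w) (by rw [List.length_append, v.2])
    rw [h2, h2, List.append_cancel_left_eq] at h3
    cases e : ε v <;> cases e' : ε' v <;> simp only [e, e', if_true] at h3 ⊢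
    · exact absurd h3.symm hw
    · exact absurd h3 hw

/-- Elements in the same left coset of `H` act alike on a level fixed by `H`. -/
theorem pow_le_index {m n : ℕ} (hm : ∃ φ : (List.Vector Bool n → Bool) → GrigorchukGroup,
    ∀ ε ε', (∀ w : List Bool, w.length = n + m → (φ ε).1 w = (φ ε').1 w) → ε = ε')
    {H : Subgroup GrigorchukGroup} [H.FiniteIndex]
    (hH : ∀ g ∈ H, ∀ v, v.length = n + m → g.1 v = v) : 2 ^ 2 ^ n ≤ H.index := by
  obtain ⟨φ, hφ⟩ := hm
  have := card_le_index (R := H) φ (fun ε ε' h => hφ ε ε' fun w hw => by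
    have h1 := hH _ h w hw
    change (φ ε).1⁻¹ ((φ ε').1 w) = w at h1
    rw [Equiv.Perm.inv_eq_iff_eq] at h1
    exact h1.symm)
  simpa [Nat.card_fun, Nat.card_eq_fintype_card, card_vector] using this

-- Upper bound for the rank, and noncyclicity

/-- Each generator added outside the current subgroup at least halves the index, so about `log₂` of
the index of `R` suffice. -/
theorem exists_finset_sup_closure_eq {G : Type*} [Group G] (H : Subgroup G) (n : ℕ) :
    ∀ R : Subgroup G, R ≤ H → R.index ≠ 0 → R.index ≤ n →
      ∃ T : Finset G, 2 ^ T.card ≤ R.index ∧ R ⊔ Subgroup.closure T = H := by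
  classical
  induction n using Nat.strong_induction_on with
  | _ n ih =>
    intro R hR h0 hn
    by_cases hRH : R = H
    · exact ⟨∅, by simpa using Nat.one_le_iff_ne_zero.mpr h0, by simpa using hRH⟩
    obtain ⟨x, hxH, hxR⟩ := SetLike.exists_of_lt (lt_of_le_of_ne hR hRH)
    set R' := R ⊔ Subgroup.closure {x} with hR'
    have hx' : x ∈ R' := (le_sup_right : _ ≤ R') (Subgroup.subset_closure rfl)
    have hmul := Subgroup.relIndex_mul_index (le_sup_left : R ≤ R')
    have h1 : R'.index ≠ 0 := fun h => h0 (by rw [← hmul, h, mul_zero])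
    have h2 : R.relIndex R' ≠ 0 := fun h => h0 (by rw [← hmul, h, zero_mul])
    have h3 : R.relIndex R' ≠ 1 := fun h => hxR (Subgroup.relIndex_eq_one.mp h hx')
    have h4 : 2 * R'.index ≤ R.index := by
      rw [← hmul]
      refine Nat.mul_le_mul_right _ ?_
      change 2 ≤ R.relIndex R'
      omega
    obtain ⟨T, hT1, hT2⟩ := ih R'.index (by omega) R'
      (sup_le hR ((Subgroup.closure_le _).mpr (by simpa using hxH))) h1 le_rfl
    refine ⟨insert x T, ?_, ?_⟩
    · calc 2 ^ (insert x T).card ≤ 2 ^ (T.card + 1) :=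
            Nat.pow_le_pow_right (by norm_num) (Finset.card_insert_le _ _)
        _ = 2 * 2 ^ T.card := by ring
        _ ≤ R.index := by omega
    · rw [Finset.coe_insert, Set.insert_eq, Subgroup.closure_union, ← sup_assoc, hT2]

theorem exists_finset_closure_levelSubgroup (k : ℕ) : ∃ T : Finset GrigorchukGroup,
    T.card ≤ 2 ^ k * Group.rank (commutator branchSubgroup) ∧
      Subgroup.closure T = levelSubgroup k := by
  classical
  obtain ⟨S, hS, hS2⟩ := Group.rank_spec (commutator branchSubgroup)
  refine ⟨Finset.univ.biUnion fun v : List.Vector Bool k => S.image fun s => branch v.1 s.1, ?_, ?_⟩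
  · refine (Finset.card_biUnion_le_card_mul _ _ _ fun v _ => Finset.card_image_le).trans ?_
    rw [Finset.card_univ, card_vector, Fintype.card_bool, hS]
  · rw [Finset.coe_biUnion]
    simp only [Finset.coe_univ, Set.mem_univ, Set.iUnion_true, Finset.coe_image]
    rw [Subgroup.closure_iUnion, levelSubgroup]
    congr 1
    funext v
    have h1 : (fun s : commutator branchSubgroup => branch v.1 s.1) =
      ((branch v.1).comp (commutator branchSubgroup).subtype) := rfl
    rw [h1, ← MonoidHom.map_closure, hS2, ← MonoidHom.range_eq_map, MonoidHom.range_comp,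
      Subgroup.range_subtype]

theorem rank_le {H : Subgroup GrigorchukGroup} [Group.FG H] {k : ℕ} (hk : levelSubgroup k ≤ H) :
    Group.rank H ≤ 2 ^ k * Group.rank (commutator branchSubgroup) +
      Nat.log 2 (levelSubgroup k).index := by
  classical
  obtain ⟨h0, -⟩ := index_levelSubgroup k
  obtain ⟨T, hT, hT2⟩ := exists_finset_closure_levelSubgroup k
  obtain ⟨U, hU, hU2⟩ := exists_finset_sup_closure_eq H _ _ hk h0 le_rfl
  have hH : H = Subgroup.closure ((T ∪ U : Finset GrigorchukGroup) : Set GrigorchukGroup) := by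
    rw [Finset.coe_union, Subgroup.closure_union, hT2, hU2]
  rw [Subgroup.rank_congr hH]
  refine (Subgroup.rank_closure_finset_le_card _).trans ((Finset.card_union_le _ _).trans ?_)
  exact add_le_add hT (Nat.le_log_of_pow_le (by norm_num) hU)

/-- Keeps `log d(H)` bounded away from zero. An infinite cyclic group has no two nontrivial
subgroups with trivial intersection, but copies below different vertices are such. -/
theorem two_le_rank {H : Subgroup GrigorchukGroup} [H.FiniteIndex] [Group.FG H] {n : ℕ}
    (hH : levelSubgroup (n + 1) ≤ H) : 2 ≤ Group.rank H := by
  by_contra! hlt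
  have hinf := infinite_grigorchukGroup
  obtain ⟨S, hS, hS2⟩ := Group.rank_spec H
  obtain ⟨h, hh⟩ : ∃ h : H, (S : Set H) ⊆ {h} := by
    have h1 : S.card ≤ 1 := by omega
    rcases Finset.card_le_one_iff_subset_singleton.mp h1 with ⟨h, hh⟩
    exact ⟨h, by simpa using Finset.coe_subset.mpr hh⟩
  have hz : ∀ x : H, ∃ i : ℤ, h ^ i = x := by
    intro x
    have : x ∈ Subgroup.closure {h} := Subgroup.closure_mono hh (hS2 ▸ Subgroup.mem_top x)
    exact Subgroup.mem_closure_singleton.mp this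
  have hHinf : Infinite H := by
    rw [← not_finite_iff_infinite]
    intro hfin
    have := Subgroup.card_mul_index H
    rw [Nat.card_eq_zero_of_infinite (α := GrigorchukGroup)] at this
    exact (mul_ne_zero Nat.card_pos.ne' Subgroup.FiniteIndex.index_ne_zero) this
  have hord : ∀ i : ℤ, h ^ i = 1 → i = 0 := by
    intro i hi
    by_contra hi0
    have : Finite (Subgroup.zpowers h) := (finite_zpowers.mpr
      (isOfFinOrder_iff_zpow_eq_one.mpr ⟨i, hi0, hi⟩)).to_subtype
    have htop : Subgroup.zpowers h = ⊤ :=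
      (Subgroup.eq_top_iff' _).mpr fun x => Subgroup.mem_zpowers_iff.mpr (hz x)
    rw [htop] at this
    have : Finite H := Subgroup.topEquiv.toEquiv.finite_iff.mp this
    exact not_finite H
  obtain ⟨k, hk, hk1⟩ := exists_mem_commutator_ne_one
  let u : Bool → List.Vector Bool (n + 1) := fun x => List.Vector.replicate (n + 1) x
  have hu : (u true).1 ≠ (u false).1 := by
    intro h
    have := congrArg List.head? h
    simp [u, List.Vector.replicate, List.replicate_succ] at this
  have hb : ∀ x, ∃ i : ℤ, (h : GrigorchukGroup) ^ i = branch (u x).1 k := fun x => by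
    obtain ⟨i, hi⟩ := hz ⟨_, hH (branch_mem_levelSubgroup (u x) hk)⟩
    exact ⟨i, by simpa using congrArg Subtype.val hi⟩
  have hne : ∀ x, branch (u x).1 k ≠ 1 := fun x hx => hk1 (branch_injective _ (by rw [hx, map_one]))
  obtain ⟨i, hi⟩ := hb true
  obtain ⟨j, hj⟩ := hb false
  -- Both sides are `h ^ (i * j)`, with supports below different vertices.
  have hij : branch (u true).1 (k ^ j) = branch (u false).1 (k ^ i) := by
    rw [map_zpow, map_zpow, ← hi, ← hj, ← zpow_mul, ← zpow_mul, mul_comm]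
  have hkj : k ^ j = 1 := by
    apply Subtype.ext; apply Subtype.ext
    ext1 w
    have h1 := branch_append (u true).1 (k ^ j) w
    rw [hij, branch_append_of_ne _ ((u false).2.trans (u true).2.symm) hu.symm,
      List.append_cancel_left_eq] at h1
    exact h1.symm
  have h1 : h ^ (i * j) = 1 := by
    apply Subtype.ext
    rw [zpow_mul]
    push_cast
    rw [hi, ← map_zpow, hkj, map_one]
  rcases mul_eq_zero.mp (hord _ h1) with h0 | h0
  · exact hne true (by rw [← hi, h0, zpow_zero])
  · exact hne false (by rw [← hj, h0, zpow_zero])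

-- Lower bound for the rank by unipotent action over `ZMod 2`

open scoped Pointwise in
/-- The monoid generated by elements `1 + s`, where all products of `c` factors `s` vanish, lies in
the span of the products of fewer than `c` factors. -/
theorem exists_finite_of_pow_eq_zero {R : Type*} [Ring R] [Algebra (ZMod 2) R] [DecidableEq R]
    (S : Finset R) (c : ℕ) (h : ∀ x ∈ S ^ c, x = 0) :
    ∃ F : Set R, F.Finite ∧ F.ncard ≤ 2 ^ ((S.card + 1) ^ c) ∧ 1 ∈ F ∧
      ∀ s ∈ S, ∀ x ∈ F, (1 + s) * x ∈ F := by
  set S' : Finset R := insert 1 S with hS'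
  -- A factor `1` can be dropped from a product, unless all factors come from `S`.
  have hstep : ∀ j : ℕ, S' ^ (j + 1) ⊆ S' ^ j ∪ S ^ (j + 1) := by
    intro j
    induction j with
    | zero =>
      intro x hx
      rw [zero_add, pow_one, hS', Finset.mem_insert] at hx
      simpa using hx
    | succ j ih =>
      intro x hx
      rw [pow_succ', Finset.mem_mul] at hx
      obtain ⟨s, hs, y, hy, rfl⟩ := hx
      rcases Finset.mem_insert.mp hs with rfl | hs'
      · rw [one_mul]; exact Finset.mem_union_left _ hy
      · rcases Finset.mem_union.mp (ih hy) with h1 | h1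
        · exact Finset.mem_union_left _ (by rw [pow_succ']; exact Finset.mul_mem_mul hs h1)
        · exact Finset.mem_union_right _ (by rw [pow_succ']; exact Finset.mul_mem_mul hs' h1)
  let V := Submodule.span (ZMod 2) ((S' ^ c : Finset R) : Set R)
  have hfd : Module.Finite (ZMod 2) V := Module.Finite.span_finset _ _
  have hfin : Finite V := Module.finite_of_finite (ZMod 2)
  have hS'c : S'.card ≤ S.card + 1 := Finset.card_insert_le _ _
  refine ⟨V, Set.toFinite _, ?_, ?_, ?_⟩
  · have h1 : Nat.card V = 2 ^ Module.finrank (ZMod 2) V := by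
      rw [Module.natCard_eq_pow_finrank (K := ZMod 2)]; simp
    have h2 : Module.finrank (ZMod 2) V ≤ (S.card + 1) ^ c :=
      (finrank_span_finset_le_card _).trans (Finset.card_pow_le.trans (Nat.pow_le_pow_left hS'c c))
    exact h1.le.trans (Nat.pow_le_pow_right (by norm_num) h2)
  · refine Submodule.subset_span ?_
    have : (1 : R) ^ c ∈ S' ^ c := Finset.pow_mem_pow (Finset.mem_insert_self _ _)
    exact Finset.mem_coe.mpr (by simpa using this)
  · intro s hs x hx
    rw [add_mul, one_mul]
    refine V.add_mem hx ?_
    have hle : V ≤ V.comap (LinearMap.mulLeft (ZMod 2) s) := by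
      refine Submodule.span_le.mpr fun m hm => ?_
      have h1 : s * m ∈ S' ^ (c + 1) := by
        rw [pow_succ']; exact Finset.mul_mem_mul (Finset.mem_insert_of_mem hs) hm
      rcases Finset.mem_union.mp (hstep c h1) with h2 | h2
      · exact Submodule.subset_span h2
      · rw [pow_succ, Finset.mem_mul] at h2
        obtain ⟨y, hy, z, -, hyz⟩ := h2
        change s * m ∈ V
        rw [← hyz, h y hy, zero_mul]
        exact V.zero_mem
    exact hle hx

/-- The difference operator of a group element on `ZMod 2`-valued functions on the tree. -/
def difference (h : GrigorchukGroup) (f : List Bool → ZMod 2) : List Bool → ZMod 2 :=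
  fun w => f (h.1 w) + f w

theorem difference_apply (h : GrigorchukGroup) (f : List Bool → ZMod 2) (w : List Bool) :
    difference h f w = f (h.1 w) + f w := rfl

/-- The difference of the values of `f` at the two children. -/
def childSum (f : List Bool → ZMod 2) : List Bool → ZMod 2 :=
  fun w => f (w ++ [true]) + f (w ++ [false])

theorem exists_apply_append_singleton (h : GrigorchukGroup) (w : List Bool) :
    (h.1 (w ++ [true]) = h.1 w ++ [true] ∧ h.1 (w ++ [false]) = h.1 w ++ [false]) ∨
    (h.1 (w ++ [true]) = h.1 w ++ [false] ∧ h.1 (w ++ [false]) = h.1 w ++ [true]) := by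
  have h1 : ∀ x, ∃ y, (sect h w).1 [x] = [y] := fun x =>
    List.length_eq_one_iff.mp (length_apply (sect h w) [x])
  obtain ⟨x, hx⟩ := h1 true
  obtain ⟨y, hy⟩ := h1 false
  have hxy : x ≠ y := by
    rintro rfl
    have := (sect h w).1.injective (hx.trans hy.symm)
    simp at this
  rw [apply_append, apply_append, hx, hy]
  cases x <;> cases y <;> simp_all

/-- A tree automorphism preserves or swaps a pair of siblings, and the sum over the pair is
symmetric. -/
theorem childSum_difference (h : GrigorchukGroup) (f : List Bool → ZMod 2) :
    childSum (difference h f) = difference h (childSum f) := by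
  funext w
  simp only [childSum, difference]
  rcases exists_apply_append_singleton h w with ⟨h1, h2⟩ | ⟨h1, h2⟩ <;> rw [h1, h2] <;> ring

theorem childSum_foldr (l : List GrigorchukGroup) (f : List Bool → ZMod 2) :
    childSum (l.foldr difference f) = l.foldr difference (childSum f) := by
  induction l with
  | nil => rfl
  | cons h l ih => rw [List.foldr_cons, childSum_difference, ih, List.foldr_cons]

theorem foldr_difference_eq_zero (l : List GrigorchukGroup) {f : List Bool → ZMod 2} {N : ℕ}
    (hf : ∀ w : List Bool, w.length = N → f w = 0) :
    ∀ w : List Bool, w.length = N → l.foldr difference f w = 0 := by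
  induction l with
  | nil => exact hf
  | cons h l ih =>
    intro w hw
    rw [List.foldr_cons, difference_apply, ih w hw, ih _ ((length_apply h w).trans hw), add_zero]

theorem foldr_difference_append_false (l : List GrigorchukGroup) {f : List Bool → ZMod 2} {N : ℕ}
    (hf : ∀ w : List Bool, w.length = N → childSum f w = 0) :
    ∀ w : List Bool, w.length = N → l.foldr difference f (w ++ [false]) =
      l.foldr difference (fun w => f (w ++ [false])) w := by
  induction l with
  | nil => exact fun w _ => rfl
  | cons h l ih =>
    intro w hw
    have hw' : (h.1 w).length = N := (length_apply h w).trans hw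
    have h0 : childSum (l.foldr difference f) (h.1 w) = 0 := by
      rw [childSum_foldr]; exact foldr_difference_eq_zero l hf _ hw'
    have h1 := CharTwo.add_eq_zero.mp h0
    simp only [List.foldr_cons, difference_apply]
    rw [← ih w hw, ← ih _ hw']
    rcases exists_apply_append_singleton h w with ⟨h2, h3⟩ | ⟨h2, h3⟩
    · rw [h3]
    · rw [h3, h1]

/-- A product of `2 ^ j` difference operators of elements fixing level `n` vanishes on functions on
level `n + j`. -/
theorem foldr_difference_of_length {n : ℕ} (j : ℕ) : ∀ (l : List GrigorchukGroup),
    (∀ h ∈ l, ∀ v : List Bool, v.length = n → h.1 v = v) → l.length = 2 ^ j →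
    ∀ (f : List Bool → ZMod 2) (w : List Bool), w.length = n + j → l.foldr difference f w = 0 := by
  induction j with
  | zero =>
    intro l hl hlen f w hw
    obtain ⟨h, rfl⟩ := List.length_eq_one_iff.mp (hlen.trans (pow_zero 2))
    simp only [List.foldr_cons, List.foldr_nil, difference_apply]
    rw [hl h (by simp) w hw, CharTwo.add_self_eq_zero]
  | succ j ih =>
    intro l hl hlen f w hw
    have h1 : (l.take (2 ^ j)).length = 2 ^ j := by rw [List.length_take, hlen, pow_succ]; omega
    have h2 : (l.drop (2 ^ j)).length = 2 ^ j := by rw [List.length_drop, hlen, pow_succ]; omega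
    have hl1 := fun h hh => hl h (List.mem_of_mem_take (i := 2 ^ j) hh)
    have hl2 := fun h hh => hl h (List.mem_of_mem_drop (i := 2 ^ j) hh)
    rw [← List.take_append_drop (2 ^ j) l, List.foldr_append]
    set g := (l.drop (2 ^ j)).foldr difference f
    -- The inner half of the operators annihilates child sums, so `g` agrees on siblings and
    -- descends to level `n + j`, where the outer half annihilates it.
    have hg : ∀ w : List Bool, w.length = n + j → childSum g w = 0 := by
      intro w hw
      rw [childSum_foldr]
      exact ih _ hl2 h2 _ w hw
    obtain ⟨v, x, rfl⟩ : ∃ v x, w = v ++ [x] :=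
      ⟨_, _, (List.dropLast_append_getLast (by rintro rfl; simp at hw)).symm⟩
    have hv : v.length = n + j := by simp at hw; omega
    have hfalse : (l.take (2 ^ j)).foldr difference g (v ++ [false]) = 0 := by
      rw [foldr_difference_append_false _ hg v hv]
      exact ih _ hl1 h1 _ v hv
    cases x
    · exact hfalse
    · have h3 : childSum ((l.take (2 ^ j)).foldr difference g) v = 0 := by
        rw [childSum_foldr]
        exact foldr_difference_eq_zero _ hg v hv
      rw [CharTwo.add_eq_zero.mp h3, hfalse]

/-- The action on the words of a given length. -/
def levelMap (N : ℕ) (g : GrigorchukGroup) (v : List.Vector Bool N) : List.Vector Bool N :=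
  ⟨g.1 v.1, (length_apply g v.1).trans v.2⟩

/-- The operator induced by a group element on functions on a level. -/
def levelOperator (N : ℕ) (g : GrigorchukGroup) :
    Module.End (ZMod 2) (List.Vector Bool N → ZMod 2) :=
  LinearMap.funLeft (ZMod 2) (ZMod 2) (levelMap N g)

theorem levelOperator_apply (N : ℕ) (g : GrigorchukGroup) (f : List.Vector Bool N → ZMod 2)
    (v : List.Vector Bool N) : levelOperator N g f v = f (levelMap N g v) := rfl

theorem levelOperator_mul (N : ℕ) (g h : GrigorchukGroup) :
    levelOperator N (g * h) = levelOperator N h * levelOperator N g := rfl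

theorem levelMap_eq_of_levelOperator_eq {N : ℕ} {g h : GrigorchukGroup}
    (H : levelOperator N g = levelOperator N h) : levelMap N g = levelMap N h := by
  classical
  funext v
  have := congrFun (LinearMap.congr_fun H (Pi.single (levelMap N g v) 1)) v
  rw [levelOperator_apply, levelOperator_apply, Pi.single_eq_same] at this
  by_contra hne
  rw [Pi.single_eq_of_ne (fun h => hne h.symm)] at this
  exact one_ne_zero this

theorem prod_levelOperator_sub_one (N : ℕ) (l : List GrigorchukGroup)
    (F : List.Vector Bool N → ZMod 2) (f : List Bool → ZMod 2) (hf : ∀ v, F v = f v.1)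
    (v : List.Vector Bool N) :
    (l.map fun g => levelOperator N g - 1).prod F v = l.foldr difference f v.1 := by
  induction l generalizing v with
  | nil => simpa using hf v
  | cons h l ih =>
    rw [List.map_cons, List.prod_cons, Module.End.mul_apply, LinearMap.sub_apply, Pi.sub_apply,
      levelOperator_apply, Module.End.one_apply, ih, ih, List.foldr_cons, difference_apply,
      CharTwo.sub_eq_add]
    rfl

theorem prod_levelOperator_eq_zero {n j : ℕ} {l : List GrigorchukGroup}
    (hl : ∀ h ∈ l, ∀ v : List Bool, v.length = n → h.1 v = v) (hlen : l.length = 2 ^ j) :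
    (l.map fun g => levelOperator (n + j) g - 1).prod = 0 := by
  refine LinearMap.ext fun F => funext fun v => ?_
  rw [prod_levelOperator_sub_one (n + j) l F
    (fun w => if h : w.length = n + j then F ⟨w, h⟩ else 0)]
  · exact foldr_difference_of_length j l hl hlen _ v.1 v.2
  · intro v
    rw [dif_pos v.2]
    rfl

open scoped Pointwise in
theorem exists_list_of_mem_pow {M ι : Type*} [Monoid M] [DecidableEq M] (u : ι → M) (U : Finset ι)
    (c : ℕ) : ∀ x ∈ (U.image u) ^ c, ∃ l : List ι, (∀ i ∈ l, i ∈ U) ∧ l.length = c ∧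
      (l.map u).prod = x := by
  induction c with
  | zero => intro x hx; exact ⟨[], by simp, rfl, by simpa [eq_comm] using hx⟩
  | succ c ih =>
    intro x hx
    rw [pow_succ', Finset.mem_mul] at hx
    obtain ⟨y, hy, z, hz, rfl⟩ := hx
    obtain ⟨i, hi, rfl⟩ := Finset.mem_image.mp hy
    obtain ⟨l, h1, h2, rfl⟩ := ih z hz
    exact ⟨i :: l, by simpa using ⟨hi, h1⟩, by simp [h2], by simp⟩

/-- A subgroup fixing level `n` with few generators has few actions on level `n + j`. -/
theorem card_le_of_generators {n j : ℕ} {H : Subgroup GrigorchukGroup} [Group.FG H]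
    (hH : ∀ g ∈ H, ∀ v : List Bool, v.length = n → g.1 v = v) {X : Type*} (φ : X → GrigorchukGroup)
    (hφ : ∀ x, φ x ∈ H)
    (hinj : ∀ x y, (∀ w : List Bool, w.length = n + j → (φ x).1 w = (φ y).1 w) → x = y) :
    Nat.card X ≤ 2 ^ ((2 * Group.rank H + 1) ^ 2 ^ j) := by
  classical
  obtain ⟨S, hS, hS2⟩ := Group.rank_spec H
  -- The linear bound concerns products of the given operators only, so inverses must be included.
  let U : Finset H := S ∪ S.image (fun s => s⁻¹)
  have hU : U.card ≤ 2 * Group.rank H := by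
    have h2 : (S.image fun s => s⁻¹).card ≤ S.card := Finset.card_image_le
    have h3 : U.card ≤ S.card + (S.image fun s => s⁻¹).card := Finset.card_union_le _ _
    omega
  let u : H → Module.End (ZMod 2) (List.Vector Bool (n + j) → ZMod 2) :=
    fun g => levelOperator (n + j) g.1 - 1
  obtain ⟨F, hF, hcard, h1, hmul⟩ := exists_finite_of_pow_eq_zero (U.image u) (2 ^ j) (by
    intro x hx
    obtain ⟨l, -, h2, rfl⟩ := exists_list_of_mem_pow u U _ x hx
    have := prod_levelOperator_eq_zero (n := n) (j := j) (l := l.map Subtype.val)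
      (fun h hh => by
        obtain ⟨g, -, rfl⟩ := List.mem_map.mp hh
        exact hH g.1 g.2) (by rw [List.length_map, h2])
    rw [List.map_map] at this
    exact this)
  have hmul' : ∀ s ∈ U, ∀ g : H, levelOperator (n + j) g.1 ∈ F →
      levelOperator (n + j) (g * s).1 ∈ F := by
    intro s hs g hg
    have := hmul (u s) (Finset.mem_image_of_mem _ hs) _ hg
    rwa [add_sub_cancel, ← levelOperator_mul] at this
  have hall : ∀ g : H, levelOperator (n + j) g.1 ∈ F := by
    intro g
    have hg : g ∈ Subgroup.closure (S : Set H) := hS2 ▸ Subgroup.mem_top g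
    -- `levelOperator` reverses products: multiplying on the right in `H` is multiplying operators
    -- on the left.
    induction hg using Subgroup.closure_induction_right with
    | one => exact h1
    | mul_right y _ s hs hy => exact hmul' s (Finset.mem_union_left _ hs) y hy
    | mul_inv_cancel y _ s hs hy =>
      exact hmul' s⁻¹ (Finset.mem_union_right _ (Finset.mem_image_of_mem _ hs)) y hy
  have : Finite F := hF
  have hle := Nat.card_le_card_of_injective
    (fun x => (⟨levelOperator (n + j) (φ x), hall ⟨φ x, hφ x⟩⟩ : F)) (fun x y hxy => by
      refine hinj x y fun w hw => ?_
      have := congrFun (levelMap_eq_of_levelOperator_eq (congrArg Subtype.val hxy)) ⟨w, hw⟩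
      exact congrArg Subtype.val this)
  rw [Nat.card_coe_set_eq] at hle
  refine hle.trans (hcard.trans (Nat.pow_le_pow_right (by norm_num) (Nat.pow_le_pow_left ?_ _)))
  exact Nat.add_le_add_right (Finset.card_image_le.trans hU) 1

-- Bounds in terms of the last fixed level

/-- The index and the rank of a normal subgroup in terms of the largest level which it fixes. -/
theorem exists_bounds : ∃ M m c : ℕ, 1 ≤ M ∧ ∀ (H : Subgroup GrigorchukGroup) [H.Normal], H ≠ ⊥ →
    ∃ (n : ℕ) (_ : H.FiniteIndex), H.index ≤ 2 ^ (4 ^ (n + 1) * M) ∧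
      Group.rank H ≤ 4 ^ (n + 1) * M ∧ (m ≤ n → 2 ^ 2 ^ (n - m) ≤ H.index) ∧
      2 ^ (n + 1) ≤ (2 * Group.rank H + 1) ^ c ∧ 2 ≤ Group.rank H := by
  obtain ⟨m, hm⟩ := exists_independent
  set q := branchCommutator.index
  set r := Group.rank (commutator branchSubgroup)
  refine ⟨r + q + 1, m, 2 ^ (m + 1), by omega, fun H hN hH => ?_⟩
  obtain ⟨n, hfix, g, hg, v, hv, hgv⟩ := exists_moved_level hH
  have hle : levelSubgroup (n + 1) ≤ H := levelSubgroup_le hg hv hgv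
  obtain ⟨h0, h1⟩ := index_levelSubgroup (n + 1)
  have hdvd := Subgroup.index_dvd_of_le hle
  have hfi : H.FiniteIndex := ⟨fun h => h0 (by rw [h] at hdvd; exact zero_dvd_iff.mp hdvd)⟩
  have h2 : (levelSubgroup (n + 1)).index ≤ 2 ^ ((n + 1 + q) * 2 ^ (n + 1)) := by
    refine h1.trans ?_
    rw [← mul_pow, pow_mul, pow_add 2 (n + 1) q]
    exact Nat.pow_le_pow_left (Nat.mul_le_mul_left _ Nat.lt_two_pow_self.le) _
  have h4 : (4 : ℕ) ^ (n + 1) = 2 ^ (n + 1) * 2 ^ (n + 1) := by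
    rw [← mul_pow]; norm_num
  have hk : n + 2 ≤ 2 ^ (n + 1) := Nat.lt_two_pow_self (n := n + 1)
  refine ⟨n, hfi, ?_, ?_, ?_, ?_, two_le_rank hle⟩
  · refine (Nat.le_of_dvd (Nat.pos_of_ne_zero h0) hdvd).trans
      (h2.trans (Nat.pow_le_pow_right (by norm_num) ?_))
    rw [h4, mul_assoc, mul_comm]
    exact Nat.mul_le_mul_left _ (by nlinarith)
  · refine (rank_le hle).trans ?_
    have h3 : Nat.log 2 (levelSubgroup (n + 1)).index ≤ (n + 1 + q) * 2 ^ (n + 1) := by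
      refine (Nat.log_mono_right h2).trans ?_
      rw [Nat.log_pow (by norm_num)]
    rw [h4, mul_assoc]
    calc _ ≤ 2 ^ (n + 1) * r + (n + 1 + q) * 2 ^ (n + 1) := Nat.add_le_add_left h3 _
      _ = 2 ^ (n + 1) * (r + (n + 1 + q)) := by ring
      _ ≤ _ := Nat.mul_le_mul_left _ (by nlinarith)
  · intro hmn
    obtain ⟨φ, -, h⟩ := hm (n - m)
    refine pow_le_index ⟨φ, h⟩ ?_
    rwa [Nat.sub_add_cancel hmn]
  · obtain ⟨φ, hφ, h⟩ := hm (n + 1)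
    -- Copies below level `n + 1` are told apart on level `n + 1 + m`, that is `m + 1` levels below
    -- the fixed one.
    have := card_le_of_generators (n := n) (j := m + 1) hfix φ (fun ε => hle (hφ ε))
      (fun ε ε' h' => h ε ε' fun w hw => h' w (by omega))
    rw [Nat.card_fun, Nat.card_eq_fintype_card, Nat.card_eq_fintype_card, card_vector,
      Fintype.card_bool] at this
    exact (Nat.pow_le_pow_iff_right (by norm_num)).mp this

-- Passage to logarithms

theorem log_log_three_pos : 0 < Real.log (Real.log 3) := by
  refine Real.log_pos ?_
  rw [Real.lt_log_iff_exp_lt (by norm_num)]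
  exact Real.exp_one_lt_d9.trans (by norm_num)

theorem exists_log_rank_le (M m : ℕ) (hM : 1 ≤ M) : ∃ A : ℝ, 0 ≤ A ∧ ∀ n i d : ℕ, 1 ≤ d →
    d ≤ 4 ^ (n + 1) * M → (m ≤ n → 2 ^ 2 ^ (n - m) ≤ i) →
    Real.log d ≤ A + 2 * Real.log (Real.log (max i 3 : ℕ)) := by
  have hl2 : 0 < Real.log 2 := Real.log_pos (by norm_num)
  have hll2 : Real.log (Real.log 2) < 0 :=
    Real.log_neg hl2 (Real.log_two_lt_d9.trans (by norm_num))
  have hlM : 0 ≤ Real.log M := Real.log_natCast_nonneg M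
  have hM' : (0 : ℝ) < M := by exact_mod_cast hM
  have hl4 : Real.log 4 = 2 * Real.log 2 := by
    rw [show (4 : ℝ) = 2 ^ 2 by norm_num, Real.log_pow]; norm_num
  -- The `m * log 2` term also covers `n < m`, where no lower bound on `i` is available; `max i 3`
  -- keeps the double logarithm positive.
  refine ⟨2 * Real.log 2 + 2 * (m * Real.log 2) - 2 * Real.log (Real.log 2) + Real.log M,
    by have : 0 ≤ m * Real.log 2 := by positivity
       linarith, fun n i d hd hdM hi => ?_⟩
  have h1 : Real.log d ≤ (n + 1) * (2 * Real.log 2) + Real.log M := by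
    have : (d : ℝ) ≤ 4 ^ (n + 1) * M := by exact_mod_cast hdM
    refine (Real.log_le_log (by exact_mod_cast hd) this).trans (le_of_eq ?_)
    rw [Real.log_mul (by positivity) hM'.ne', Real.log_pow, hl4]
    push_cast; ring
  have hJ : (3 : ℝ) ≤ (max i 3 : ℕ) := by exact_mod_cast le_max_right i 3
  have hlJ := Real.log_le_log (by norm_num) hJ
  have hl3 : 0 < Real.log 3 := Real.log_pos (by norm_num)
  have hllJ : 0 < Real.log (Real.log (max i 3 : ℕ)) :=
    log_log_three_pos.trans_le (Real.log_le_log hl3 hlJ)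
  have h2 : n * Real.log 2 ≤
      m * Real.log 2 - Real.log (Real.log 2) + Real.log (Real.log (max i 3 : ℕ)) := by
    rcases le_or_gt m n with hmn | hmn
    · have h3 : (2 : ℝ) ^ 2 ^ (n - m) ≤ (max i 3 : ℕ) := by
        exact_mod_cast (hi hmn).trans (le_max_left i 3)
      have h4 := Real.log_le_log (by positivity) h3
      rw [Real.log_pow] at h4
      push_cast at h4
      have h5 := Real.log_le_log (by positivity) h4
      rw [Real.log_mul (by positivity) hl2.ne', Real.log_pow, Nat.cast_sub hmn] at h5
      push_cast at h5 ⊢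
      linarith
    · have : (n : ℝ) * Real.log 2 ≤ m * Real.log 2 :=
        mul_le_mul_of_nonneg_right (by exact_mod_cast hmn.le) hl2.le
      linarith
  linarith

theorem exists_log_index_le (M c : ℕ) (hM : 1 ≤ M) : ∃ B : ℝ, 0 ≤ B ∧ ∀ n i d : ℕ, 2 ≤ d →
    i ≤ 2 ^ (4 ^ (n + 1) * M) → 2 ^ (n + 1) ≤ (2 * d + 1) ^ c → 3 ≤ i →
    Real.log (Real.log i) ≤ B * Real.log d := by
  have hl2 : 0 < Real.log 2 := Real.log_pos (by norm_num)
  have hl2' : Real.log 2 ≤ 1 := (Real.log_two_lt_d9.trans (by norm_num)).le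
  have hlM : 0 ≤ Real.log M := Real.log_natCast_nonneg M
  have hM' : (0 : ℝ) < M := by exact_mod_cast hM
  have hl4 : Real.log 4 = 2 * Real.log 2 := by
    rw [show (4 : ℝ) = 2 ^ 2 by norm_num, Real.log_pow]; norm_num
  -- The 6 is 2 from `4 = 2 ^ 2` times 3 from `2 * d + 1 ≤ d ^ 3`; the quotient absorbs `log M`, as
  -- `d ≥ 2`.
  refine ⟨6 * c + Real.log M / Real.log 2, by positivity, fun n i d hd hi hc h3i => ?_⟩
  have hd' : (2 : ℝ) ≤ d := by exact_mod_cast hd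
  have hld : Real.log 2 ≤ Real.log d := Real.log_le_log (by norm_num) hd'
  have hli : 0 < Real.log i := Real.log_pos (by exact_mod_cast (by omega : 1 < i))
  have h1 : Real.log i ≤ 4 ^ (n + 1) * M := by
    have : (i : ℝ) ≤ 2 ^ (4 ^ (n + 1) * M) := by exact_mod_cast hi
    have h2 := Real.log_le_log (by positivity) this
    rw [Real.log_pow] at h2
    push_cast at h2
    exact h2.trans (mul_le_of_le_one_right (by positivity) hl2')
  have h2 : Real.log (Real.log i) ≤ (n + 1) * (2 * Real.log 2) + Real.log M := by
    refine (Real.log_le_log hli h1).trans (le_of_eq ?_)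
    rw [Real.log_mul (by positivity) hM'.ne', Real.log_pow, hl4]
    push_cast; ring
  have h3 : (n + 1) * Real.log 2 ≤ c * (3 * Real.log d) := by
    have h4 : (2 : ℝ) ^ (n + 1) ≤ (2 * d + 1) ^ c := by exact_mod_cast hc
    have h5 := Real.log_le_log (by positivity) h4
    rw [Real.log_pow, Real.log_pow] at h5
    have h6 : Real.log (2 * d + 1) ≤ 3 * Real.log d := by
      have h7 : (2 : ℝ) * d + 1 ≤ d ^ 3 := by
        have h8 : (4 : ℝ) ≤ d ^ 2 := by nlinarith
        nlinarith
      have := Real.log_le_log (by positivity) h7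
      rwa [Real.log_pow] at this
    push_cast at h5
    exact h5.trans (mul_le_mul_of_nonneg_left h6 (by positivity))
  have h4 : Real.log M ≤ Real.log M / Real.log 2 * Real.log d := by
    rw [div_mul_eq_mul_div, le_div_iff₀ hl2]
    exact mul_le_mul_of_nonneg_left hld hlM
  nlinarith

theorem exists_log_bounds : ∃ D : ℝ, 1 < D ∧ ∀ (H : Subgroup GrigorchukGroup) [H.Normal], H ≠ ⊥ →
    ∃ _ : H.FiniteIndex, 2 ≤ Group.rank H ∧
      Real.log (Group.rank H) ≤ D * Real.log (Real.log (max H.index 3 : ℕ)) ∧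
      Real.log (Real.log H.index) ≤ D * Real.log (Group.rank H) := by
  obtain ⟨M, m, c, hM, hb⟩ := exists_bounds
  obtain ⟨A, hA, hA'⟩ := exists_log_rank_le M m hM
  obtain ⟨B, hB, hB'⟩ := exists_log_index_le M c hM
  have hε := log_log_three_pos
  refine ⟨A / Real.log (Real.log 3) + 2 + B, by
    have : 0 ≤ A / Real.log (Real.log 3) := by positivity
    linarith, fun H _ hH => ?_⟩
  obtain ⟨n, hfi, h1, h2, h3, h4, h5⟩ := hb H hH
  have hd : 0 ≤ Real.log (Group.rank H) := Real.log_natCast_nonneg _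
  have hAε : 0 ≤ A / Real.log (Real.log 3) := by positivity
  refine ⟨hfi, h5, ?_, ?_⟩
  · have h6 := hA' n H.index (Group.rank H) (by omega) h2 h3
    have hJ : (3 : ℝ) ≤ (max H.index 3 : ℕ) := by exact_mod_cast le_max_right _ 3
    have h7 : Real.log (Real.log 3) ≤ Real.log (Real.log (max H.index 3 : ℕ)) :=
      Real.log_le_log (Real.log_pos (by norm_num)) (Real.log_le_log (by norm_num) hJ)
    have h8 : A ≤ A / Real.log (Real.log 3) * Real.log (Real.log (max H.index 3 : ℕ)) := by
      rw [div_mul_eq_mul_div, le_div_iff₀ hε]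
      exact mul_le_mul_of_nonneg_left h7 hA
    have h9 := mul_nonneg hB (hε.le.trans h7)
    nlinarith
  · rcases Nat.lt_or_ge H.index 3 with h6 | h6
    · have : Real.log (Real.log H.index) ≤ 0 := by
        have h0 : H.index ≠ 0 := hfi.index_ne_zero
        have h7 : H.index = 1 ∨ H.index = 2 := by omega
        rcases h7 with h7 | h7 <;> rw [h7]
        · simp
        · exact Real.log_nonpos (Real.log_natCast_nonneg _)
            (by push_cast; exact (Real.log_two_lt_d9.trans (by norm_num)).le)
      exact this.trans (by positivity)
    · refine (hB' n _ _ h5 h1 h4 h6).trans ?_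
      exact mul_le_mul_of_nonneg_right (by linarith) hd

end Grigorchuk

open Grigorchuk in
theorem theorem1 :
    IsNormallyRGRigid (fun n : ℕ => Real.log (Real.log (n : ℝ))) (fun n : ℕ => Real.log (n : ℝ))
      GrigorchukGroup ∧
    ∃ D : ℝ, 1 < D ∧ ∀ (H : Subgroup GrigorchukGroup) [H.Normal], H ≠ ⊥ →
      ∃ _ : H.FiniteIndex,
        (2 < H.index →
          (1 / D) * Real.log (Group.rank H : ℝ) ≤ Real.log (Real.log (H.index : ℝ))) ∧
        (H ≠ ⊤ →
          Real.log (Real.log (H.index : ℝ)) ≤ D * Real.log (Group.rank H : ℝ)) := by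
  obtain ⟨D, hD, hb⟩ := exists_log_bounds
  have hD0 : 0 < D := one_pos.trans hD
  refine ⟨?_, D, hD, fun H _ hH => ?_⟩
  -- `C > 3` gives `max H.index 3 ≤ C * H.index`; `C > D` makes the inequalities strict, as the
  -- logarithms multiplied are positive.
  · obtain ⟨C, hC⟩ := exists_nat_gt (max D 3)
    have hCD : D < C := (le_max_left _ _).trans_lt hC
    have hC3 : 3 < C := by exact_mod_cast (le_max_right D 3).trans_lt hC
    refine ⟨C, fun H _ hfi => ?_⟩
    have hH : H ≠ ⊥ := by
      rintro rfl
      have := infinite_grigorchukGroup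
      exact hfi.index_ne_zero (by rw [Subgroup.index_bot, Nat.card_eq_zero_of_infinite])
    obtain ⟨_, h2, h3, h4⟩ := hb H hH
    have hi : 0 < H.index := Nat.pos_of_ne_zero hfi.index_ne_zero
    constructor
    · have hmax : max H.index 3 ≤ C * H.index := max_le (by nlinarith) (by nlinarith)
      have hJ : (3 : ℝ) ≤ (max H.index 3 : ℕ) := by exact_mod_cast le_max_right _ 3
      have hl3 : 0 < Real.log 3 := Real.log_pos (by norm_num)
      have h5 := Real.log_le_log (by norm_num) hJ
      have h6 : Real.log (max H.index 3 : ℕ) ≤ Real.log ((C * H.index : ℕ) : ℝ) :=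
        Real.log_le_log (by linarith) (by exact_mod_cast hmax)
      have h7 := Real.log_le_log (hl3.trans_le h5) h6
      have h8 : 0 < Real.log (Real.log ((C * H.index : ℕ) : ℝ)) :=
        log_log_three_pos.trans_le (Real.log_le_log hl3 (h5.trans h6))
      exact h3.trans_lt ((mul_le_mul_of_nonneg_left h7 hD0.le).trans_lt
        (mul_lt_mul_of_pos_right hCD h8))
    · have hd : (2 : ℝ) ≤ Group.rank H := by exact_mod_cast h2
      have h5 : Real.log (Group.rank H) ≤ Real.log ((C * Group.rank H : ℕ) : ℝ) :=
        Real.log_le_log (by linarith) (by exact_mod_cast Nat.le_mul_of_pos_left _ (by omega))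
      have h6 : 0 < Real.log (Group.rank H) := Real.log_pos (by linarith)
      exact h4.trans_lt ((mul_le_mul_of_nonneg_left h5 hD0.le).trans_lt
        (mul_lt_mul_of_pos_right hCD (h6.trans_le h5)))
  · obtain ⟨hfi, h2, h3, h4⟩ := hb H hH
    refine ⟨hfi, fun hi => ?_, fun _ => h4⟩
    rw [max_eq_left hi] at h3
    rw [one_div, inv_mul_le_iff₀ hD0]
    exact h3
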